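/- The arboreal height of a totally real algebraic integer $\lambda$ is the least $h$ such that there is a finite rooted tree of height $h$ whose adjacency matrix has $\lambda$ as an eigenvalue, where the height of a rooted tree is the largest distance from the root to a vertex (by a theorem of Salez such a tree always exists; formally the arboreal height is $\infty$ if there is none). Let $K$ be a totally real number field with $[K:\mathbb{Q}]\ge 3$. Then the ring of integers of $K$ contains an element of arboreal height greater than $2$. -/

import Mathlib

/-- `x` is an eigenvalue of (the adjacency matrix of) the finite graph `G`. The adjacency matrix
is a 0-1 matrix and is taken with entries in the field in which `x` lives. -/
def SimpleGraph.IsEigenvalue {V F : Type*} [Fintype V] [DecidableEq V] [Field F]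
    (G : SimpleGraph V) (x : F) : Prop :=
  open scoped Classical in
  Module.End.HasEigenvalue (Matrix.toLin' (G.adjMatrix F)) x

/-- The heights of the finite rooted trees that have `x` as an eigenvalue. The height of a tree `T`
rooted at `r` is the largest distance from `r` to a vertex of `T`, that is, the eccentricity of `r`.
Every finite tree is isomorphic to one with vertex set `Fin n`. -/
def rootedTreeHeights {F : Type*} [Field F] (x : F) : Set ℕ∞ :=
  {h | ∃ (n : ℕ) (T : SimpleGraph (Fin n)) (r : Fin n),
    T.IsTree ∧ T.eccent r = h ∧ T.IsEigenvalue x}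

/-- The arboreal height of `x`: the least height of a finite rooted tree that has `x` as an
eigenvalue (`⊤` if there is no such tree; every totally real algebraic integer has one). -/
noncomputable def arborealHeight {F : Type*} [Field F] (x : F) : ℕ∞ :=
  sInf (rootedTreeHeights x)

/-! Eliminating leaves and children from the eigenvector equation of a tree of height at most 2
gives `∑ 1 / (x² - d c) = 1`, with `d c` natural numbers, unless `x²` is itself natural. The left
side is strictly decreasing in `x²` on (0, 1), where it has no poles, so at most one conjugate of
`x²` lies there. A unit small at all places but one breaks this: degree at least 3 leaves two small
real places, and they separate `x²` because `x²` generates `K`. -/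

namespace SimpleGraph

variable {V : Type*} {T : SimpleGraph V} {r : V}

/-- In a tree, the length of any path is the distance of its ends. -/
lemma IsTree.length_eq_dist_of_isPath (hT : T.IsTree) {u v : V} {p : T.Walk u v}
    (hp : p.IsPath) : p.length = T.dist u v := by
  obtain ⟨q, hq, hl⟩ := hT.connected.exists_path_of_dist u v
  rw [← hl, (hT.existsUnique_path u v).unique hp hq]

/-- In a tree of height at most two, the vertices below a child of the root are leaves. -/
lemma IsTree.eq_of_adj_of_eccent_le_two (hT : T.IsTree) (hr : T.eccent r ≤ 2) {c u w : V}
    (hc : T.Adj r c) (hu : T.Adj c u) (hur : u ≠ r) (hw : T.Adj u w) : w = c := by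
  by_contra hwc
  have hwr : w ≠ r := by
    rintro rfl
    have h := hT.length_eq_dist_of_isPath (p := .cons hw.symm (.cons hu.symm .nil))
      (by simp [Walk.isPath_def, hur.symm, hc.ne, hu.ne'])
    rw [dist_eq_one_iff_adj.2 hc] at h
    simp at h
  have h := hT.length_eq_dist_of_isPath (p := .cons hc (.cons hu (.cons hw .nil)))
    (by simp [Walk.isPath_def, hur.symm, hc.ne, hu.ne, hw.ne, hwr.symm, Ne.symm hwc])
  have h2 := (edist_le_eccent (u := r) (v := w)).trans hr
  rw [← (hT.connected r w).coe_dist_eq_edist, ← h] at h2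
  norm_num at h2

/-- In a graph of eccentricity at most two at `r`, any vertex other than `r` is a neighbour of
`r` or has a neighbour that is adjacent to `r`. -/
lemma Connected.adj_or_exists_adj_of_eccent_le_two (hT : T.Connected) (hr : T.eccent r ≤ 2)
    {u : V} (hur : u ≠ r) : T.Adj r u ∨ ∃ c, T.Adj r c ∧ T.Adj c u := by
  obtain ⟨p, hp⟩ := hT.exists_walk_length_eq_dist r u
  have h2 := (edist_le_eccent (u := r) (v := u)).trans hr
  rw [← (hT r u).coe_dist_eq_edist, ← hp] at h2
  norm_cast at h2
  match p, h2 with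
  | .nil, _ => exact absurd rfl hur
  | .cons h .nil, _ => exact .inl h
  | .cons h (.cons h' .nil), _ => exact .inr ⟨_, h, h'⟩
  | .cons _ (.cons _ (.cons _ _)), h2 => simp at h2

/-- An eigenvalue of a rooted tree of height at most two whose square is not a natural number
satisfies the equation obtained by eliminating all vertices but the root. -/
lemma IsTree.exists_sum_inv_eq_one [Fintype V] [DecidableEq V] {F : Type*} [Field F] {x : F}
    (hT : T.IsTree) (hr : T.eccent r ≤ 2) (hx : ∀ k : ℕ, x ^ 2 ≠ k) (h : T.IsEigenvalue x) :
    ∃ (s : Finset V) (d : V → ℕ), ∑ c ∈ s, (x ^ 2 - d c)⁻¹ = 1 := by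
  classical
  have hx0 : x ≠ 0 := by
    rintro rfl
    exact hx 0 (by simp)
  have hd (k : ℕ) : x ^ 2 - k ≠ 0 := sub_ne_zero.2 (hx k)
  obtain ⟨v, hv⟩ := h.exists_hasEigenvector
  have key (u : V) : ∑ w ∈ T.neighborFinset u, v w = x * v u := by
    have := congrFun hv.apply_eq_smul u
    rw [Matrix.toLin'_apply] at this
    rw [← smul_eq_mul, ← Pi.smul_apply, ← this]
    convert (adjMatrix_mulVec_apply (α := F) (G := T) u v).symm
  have leaf {c u : V} (hc : T.Adj r c) (hu : T.Adj c u) (hur : u ≠ r) : x * v u = v c := by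
    rw [← key u, Finset.sum_eq_single_of_mem c (by simpa using hu.symm)]
    intro w hw hwc
    exact absurd (hT.eq_of_adj_of_eccent_le_two hr hc hu hur (by simpa using hw)) hwc
  -- For a child `c` of the root, this counts the leaves below `c`.
  let d (c : V) : ℕ := ((T.neighborFinset c).erase r).card
  have child {c : V} (hc : T.Adj r c) : (x ^ 2 - d c) * v c = x * v r := by
    have h1 : x * ∑ u ∈ (T.neighborFinset c).erase r, v u = d c * v c := by
      rw [Finset.mul_sum, Finset.sum_congr rfl (g := fun _ ↦ v c)]
      · simp [d]
      · intro u hu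
        rw [Finset.mem_erase, mem_neighborFinset] at hu
        exact leaf hc hu.2 hu.1
    have h2 := key c
    rw [← Finset.add_sum_erase _ _ (show r ∈ T.neighborFinset c by simpa using hc.symm)] at h2
    linear_combination h1 - x * h2
  -- If `v r = 0`, the zero propagates to the children, then to the leaves.
  have hvr : v r ≠ 0 := by
    intro h0
    have hc0 {c : V} (hc : T.Adj r c) : v c = 0 := by
      simpa [h0, hd] using child hc
    refine hv.2 (funext fun u ↦ ?_)
    by_cases hur : u = r
    · simpa [hur] using h0
    rcases hT.connected.adj_or_exists_adj_of_eccent_le_two hr hur with hu | ⟨c, hc, hu⟩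
    · exact hc0 hu
    · simpa [hc0 hc, hx0] using leaf hc hu hur
  refine ⟨T.neighborFinset r, d, mul_right_cancel₀ (mul_ne_zero hx0 hvr) ?_⟩
  rw [one_mul, Finset.sum_mul]
  refine (Finset.sum_congr rfl fun c hc ↦ ?_).trans (key r)
  rw [← child (by simpa using hc), inv_mul_cancel_left₀ (hd _)]

end SimpleGraph

/-- Two distinct conjugates of the square of an eigenvalue of a rooted tree of height at most two
cannot both lie strictly between zero and one. -/
lemma two_lt_arborealHeight {F : Type*} [Field F] {x : F} (σ τ : F →+* ℝ)
    (hσ : σ (x ^ 2) ∈ Set.Ioo 0 1) (hτ : τ (x ^ 2) ∈ Set.Ioo 0 1)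
    (hne : σ (x ^ 2) ≠ τ (x ^ 2)) : 2 < arborealHeight x := by
  -- All embeddings agree on natural numbers.
  have hx (k : ℕ) : x ^ 2 ≠ k := fun h ↦ hne (by rw [h]; simp)
  refine lt_of_lt_of_le (by norm_num : (2 : ℕ∞) < 2 + 1) (le_sInf ?_)
  rintro _ ⟨n, T, r, hT, rfl, h⟩
  refine Order.add_one_le_of_lt (lt_of_not_ge fun hr ↦ ?_)
  obtain ⟨s, d, hs⟩ := hT.exists_sum_inv_eq_one hr hx h
  have hsum (φ : F →+* ℝ) : ∑ c ∈ s, (φ (x ^ 2) - d c)⁻¹ = 1 := by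
    simpa using congrArg φ hs
  have hpos (k : ℕ) : 0 < (σ (x ^ 2) - k) * (τ (x ^ 2) - k) := by
    rcases k.eq_zero_or_pos with rfl | hk
    · simpa using mul_pos hσ.1 hτ.1
    · have hk' : (1 : ℝ) ≤ k := by exact_mod_cast hk
      exact mul_pos_of_neg_of_neg (by linarith [hσ.2]) (by linarith [hτ.2])
  -- Subtract the two equations termwise; every summand left is positive by `hpos`.
  have hdiff : (τ (x ^ 2) - σ (x ^ 2)) *
      ∑ c ∈ s, ((σ (x ^ 2) - d c) * (τ (x ^ 2) - d c))⁻¹ = 0 := by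
    rw [← sub_self (1 : ℝ)]
    nth_rw 1 [← hsum σ]
    rw [← hsum τ, ← Finset.sum_sub_distrib, Finset.mul_sum]
    refine Finset.sum_congr rfl fun c _ ↦ ?_
    have h1 := left_ne_zero_of_mul (hpos (d c)).ne'
    have h2 := right_ne_zero_of_mul (hpos (d c)).ne'
    field_simp
    ring
  have hne' : s.Nonempty := by
    rw [Finset.nonempty_iff_ne_empty]
    rintro rfl
    simp at hs
  exact mul_ne_zero (sub_ne_zero.2 hne.symm)
    (Finset.sum_pos (fun c _ ↦ inv_pos.2 (hpos (d c))) hne').ne' hdiff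

namespace NumberField

/-- There is a nonzero algebraic integer that is small at all infinite places but one. -/
lemma exists_ne_zero_forall_ne_lt_one (K : Type*) [Field K] [NumberField K]
    (w₁ : InfinitePlace K) : ∃ x : 𝓞 K, x ≠ 0 ∧ ∀ w, w ≠ w₁ → w (x : K) < 1 := by
  obtain ⟨u, hu⟩ := Units.dirichletUnitTheorem.exists_unit K w₁
  exact ⟨u, u.ne_zero, fun w hw ↦ (Real.log_neg_iff (Units.pos_at_place u w)).1 (hu w hw)⟩

end NumberField

open NumberField InfinitePlace in
theorem mainTheorem10 (K : Type*) [Field K] [NumberField K] [NumberField.IsTotallyReal K]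
    (hK : 3 ≤ Module.finrank ℚ K) :
    ∃ x : NumberField.RingOfIntegers K, 2 < arborealHeight (x : K) := by
  classical
  have hcard : 2 < Fintype.card (InfinitePlace K) := by
    have := sum_mult_eq (K := K)
    simp only [IsTotallyReal.mult_eq, Finset.sum_const, Finset.card_univ, smul_eq_mul,
      mul_one] at this
    omega
  obtain ⟨w₁, w₂, w₃, h12, h13, h23⟩ := Fintype.two_lt_card_iff.1 hcard
  obtain ⟨x, hx, hlt⟩ := exists_ne_zero_forall_ne_lt_one K w₁
  have hxK : (x : K) ≠ 0 := RingOfIntegers.coe_ne_zero_iff.2 hx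
  have hreal (w : InfinitePlace K) : w.IsReal := IsTotallyReal.isReal w
  -- Primitivity is needed for `x ^ 2`, not just `x`: the squares must differ.
  have hprim := is_primitive_element_of_infinitePlace_lt (x := x ^ 2) (w := w₁)
    (pow_ne_zero 2 hx) (fun w hw ↦ by
      simpa using pow_lt_one₀ (apply_nonneg w _) (hlt w hw) two_ne_zero) (.inl (hreal w₁))
  have hmem (w : InfinitePlace K) (hw : w ≠ w₁) :
      embedding_of_isReal (hreal w) ((x : K) ^ 2) ∈ Set.Ioo 0 1 := by
    have h0 : embedding_of_isReal (hreal w) (x : K) ≠ 0 := by simpa using hxK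
    have h1 := hlt w hw
    rw [← norm_embedding_of_isReal (hreal w), Real.norm_eq_abs] at h1
    rw [map_pow]
    exact ⟨by positivity, (sq_lt_one_iff_abs_lt_one _).2 h1⟩
  refine ⟨x, two_lt_arborealHeight _ _ (hmem w₂ h12.symm) (hmem w₃ h13.symm) fun heq ↦ h23 ?_⟩
  have hemb : w₂.embedding ((x : K) ^ 2) = w₃.embedding ((x : K) ^ 2) := by
    rw [← embedding_of_isReal_apply (hreal w₂), ← embedding_of_isReal_apply (hreal w₃), heq]
  have hall := (Field.primitive_element_iff_algHom_eq_of_eval ℚ ℂ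
    (fun _ ↦ IsAlgClosed.splits _) ((x : K) ^ 2) w₂.embedding.toRatAlgHom).1
      (by simpa using hprim) w₃.embedding.toRatAlgHom (by simpa using hemb)
  rw [← mk_embedding w₂, ← mk_embedding w₃]
  congr 1
  exact RingHom.ext fun y ↦ DFunLike.congr_fun hall y
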